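/- Let $A$ and $B$ be finite vertex classes with $n = |A|$ and $m = |B| \ge 1$. A semi-matching of a bipartite graph $(A,B,E)$ is a set $S \subseteq E$ in which every $a \in A$ has degree exactly $1$. A degree-minimizing path with respect to $S$ is a path that starts at some $b \in B$, alternates between edges of $S$ and edges of $E \setminus S$, and ends at some $b' \in B$ with $\deg_S(b') \le \deg_S(b) - 2$. A semi-matching is optimal if it admits no degree-minimizing path. Write $\deg\max S$ for the maximum degree of a vertex of $A \cup B$ in $S$. For $A' \subseteq A$ let $\mathrm{semi}(A',B,E)$ denote an optimal semi-matching of the subgraph of $(A,B,E)$ induced by $A' \cup B$. A set $S \subseteq E$ is a $\gamma$-skeleton of $(A,B,E)$ if for every $A' \subseteq A$ such that $\mathrm{semi}(A',B,E)$ exists, $\mathrm{semi}(A',B,S)$ exists and $\deg\max \mathrm{semi}(A',B,S) \le \gamma \cdot \deg\max \mathrm{semi}(A',B,E)$. In a deterministic one-way two-party protocol, $A$ and $B$ are known to both players, Alice holds $E_1$, Bob holds $E_2$, Alice sends Bob a single message (a string of bits), and Bob, from this message and $E_2$, produces an output. The protocol has approximation factor $\gamma$ if, whenever $G = (A,B,E_1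 \cup E_2)$ has a semi-matching, the output is a semi-matching $S$ of $G$ with $\deg\max S \le \gamma \cdot \deg\max S^*$, where $S^*$ is an optimal semi-matching of $G$. Theorem. There is an absolute constant $c > 0$ such that for all such $A$ and $B$ there are deterministic one-way two-party protocols for the semi-matching problem, 1. one with message size at most $c\, n \log_2 m$ bits and approximation factor $n^{1/2} + 2$, and 2. another one with message size at most $2 c\, n \log_2 m$ bits and approximation factor $2 n^{1/3} + 2$. Moreover, if $m \ge 2$, then in these protocols Alice's message encodes an $(n^{1/2}+1)$-skeleton of $(A,B,E_1)$ with at most $n$ edges in the first case, and a $(2n^{1/3}+1)$-skeleton of $(A,B,E_1)$ with at most $2n$ edges in the second case, and, whenever $G$ has a semi-matching, Bob outputs an optimal semi-matching of the graph formed by the skeleton together with $E_2$. -/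

import Mathlib

/-! Semi-matchings in bipartite graphs on vertex classes `A` and `B`.  An edge set is a finite set
of pairs `(a, b)`. -/

universe u v

namespace SemiMatching

variable {A : Type u} {B : Type v} [Fintype A] [DecidableEq A] [Fintype B] [DecidableEq B]

/-- Degree of a vertex `a ∈ A` in the edge set `S`. -/
def degA (S : Finset (A × B)) (a : A) : ℕ := (S.filter fun e => e.1 = a).card

/-- Degree of a vertex `b ∈ B` in the edge set `S`. -/
def degB (S : Finset (A × B)) (b : B) : ℕ := (S.filter fun e => e.2 = b).card

/-- The maximal degree of a vertex of `A ∪ B` in the edge set `S`. -/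
def degMax (S : Finset (A × B)) : ℕ :=
  max (Finset.univ.sup fun a => degA S a) (Finset.univ.sup fun b => degB S b)

/-- The edges of `E` whose endpoint in `A` lies in `A'`. -/
def restrict (A' : Finset A) (E : Finset (A × B)) : Finset (A × B) := E.filter fun e => e.1 ∈ A'

/-- `S` is a semi-matching of the graph `(A', B, E)`. -/
def IsSemiMatching (A' : Finset A) (E S : Finset (A × B)) : Prop :=
  S ⊆ restrict A' E ∧ ∀ a ∈ A', degA S a = 1

/-- A degree-minimizing path `(b 0, a 0, b 1, …, a (k - 1), b k)` with respect to `S` in the graph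
with edge set `E`: a path that alternates between edges of `S` and edges of `E` outside `S`, from
a vertex of `B` to a vertex of `B` whose degree is smaller by at least two. -/
structure DegMinPath (E S : Finset (A × B)) where
  k : ℕ
  b : Fin (k + 1) → B
  a : Fin k → A
  b_injective : Function.Injective b
  a_injective : Function.Injective a
  mem_S : ∀ i : Fin k, (a i, b i.castSucc) ∈ S
  mem_E : ∀ i : Fin k, (a i, b i.succ) ∈ E
  not_mem_S : ∀ i : Fin k, (a i, b i.succ) ∉ S
  deg_lt : degB S (b (Fin.last k)) + 2 ≤ degB S (b 0)

/-- `S` is an optimal semi-matching of the graph `(A', B, E)`: a semi-matching that does not admit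
any degree-minimizing path. -/
def IsOptimal (A' : Finset A) (E S : Finset (A × B)) : Prop :=
  IsSemiMatching A' E S ∧ IsEmpty (DegMinPath (restrict A' E) S)

/-- `S` is a `γ`-semi-matching skeleton of the graph `(A, B, E)`: for every `A' ⊆ A` that can be
semi-matched in `E`, the maximal degree of an optimal semi-matching of `A'` within `S` exists and is
at most `γ` times that of an optimal semi-matching of `A'` within `E`. -/
def IsSkeleton (γ : ℝ) (E S : Finset (A × B)) : Prop :=
  S ⊆ E ∧ ∀ (A' : Finset A) (T : Finset (A × B)), IsOptimal A' E T →
    ∃ T' : Finset (A × B), IsOptimal A' S T' ∧ (degMax T' : ℝ) ≤ γ * (degMax T : ℝ)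

/-- A deterministic one-way two-party protocol on the vertex classes `A` and `B`: from her edge set
Alice computes a single message of `bits` bits, and from that message and his own edge set Bob
computes the output. -/
structure OneWayProtocol (A : Type u) (B : Type v) where
  bits : ℕ
  alice : Finset (A × B) → (Fin bits → Bool)
  bob : (Fin bits → Bool) → Finset (A × B) → Finset (A × B)

/-- Bob's output when Alice holds `E₁` and Bob holds `E₂`. -/
def OneWayProtocol.output (P : OneWayProtocol A B) (E₁ E₂ : Finset (A × B)) : Finset (A × B) :=
  P.bob (P.alice E₁) E₂

/-- `P` is a `γ`-approximation protocol for the semi-matching problem: on every input graph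
`(A, B, E₁ ∪ E₂)` that has a semi-matching, the output is a semi-matching whose maximal degree is at
most `γ` times that of an optimal one. -/
def OneWayProtocol.IsApprox (P : OneWayProtocol A B) (γ : ℝ) : Prop :=
  ∀ E₁ E₂ : Finset (A × B), (∃ S, IsSemiMatching Finset.univ (E₁ ∪ E₂) S) →
    IsSemiMatching Finset.univ (E₁ ∪ E₂) (P.output E₁ E₂) ∧
      ∀ S' : Finset (A × B), IsOptimal Finset.univ (E₁ ∪ E₂) S' →
        (degMax (P.output E₁ E₂) : ℝ) ≤ γ * (degMax S' : ℝ)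

/-- In `P`, Alice's message encodes a `γ`-skeleton of her graph with at most `N` edges, and Bob
outputs an optimal semi-matching of his edges together with the skeleton. -/
def OneWayProtocol.SendsSkeleton (P : OneWayProtocol A B) (N : ℕ) (γ : ℝ) : Prop :=
  ∃ decode : (Fin P.bits → Bool) → Finset (A × B),
    (∀ E₁ : Finset (A × B), IsSkeleton γ E₁ (decode (P.alice E₁)) ∧
      (decode (P.alice E₁)).card ≤ N) ∧
    ∀ E₁ E₂ : Finset (A × B), (∃ S, IsSemiMatching Finset.univ (E₁ ∪ E₂) S) →
      IsOptimal Finset.univ (decode (P.alice E₁) ∪ E₂) (P.output E₁ E₂)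

end SemiMatching

/-! A semi-matching of `A'` is the graph of a map `f`, and optimality controls its loads: the load
at `x` exceeds the load at any `y` reachable from `x` by alternating moves by at most one
(`IsOptimal.load_le_of_reachable`). Hence optimal semi-matchings minimise the maximal degree.
Applied to single moves from `f a` to `g a`, with `g` a rival of load at most `d` on `X`, it bounds
the sum of the `f`-loads met by `X` by `d * n + #X` (`IsOptimal.sum_load_le`).

If `f` sends `s` vertices of `X` to one `b`, this gives `s² ≤ d n + s`, so a single optimal
semi-matching is already a square-root skeleton. For the cube root, every fibre of `f` is optimally
semi-matched a second time. By Hall's theorem it remains to see that no `Y ⊆ X` has too few partners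
in the union of both levels; the load inequalities of the two levels together exclude this
(`sum_le_of_load_inequalities`).

Bob's edges cost one more unit in the factor (`IsSkeleton.degMax_le`). A skeleton is one or two
partial maps from `A` to `B`, and counting these gives the message size. -/

namespace SemiMatching

open Finset

/-! ### Semi-matchings as maps, and their loads -/

section

variable {A : Type u} {B : Type v}

/-- The edge set assigning to each vertex `a` of `A'` its partner `f a`. -/
def graphOn [DecidableEq A] [DecidableEq B] (A' : Finset A) (f : A → B) : Finset (A × B) :=
  A'.image fun a => (a, f a)

/-- The number of vertices of `A'` that `f` assigns to `b`. -/
def load [DecidableEq B] (A' : Finset A) (f : A → B) (b : B) : ℕ := #{a ∈ A' | f a = b}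

theorem load_mono [DecidableEq B] {X Y : Finset A} (h : X ⊆ Y) (f : A → B) (b : B) :
    load X f b ≤ load Y f b :=
  card_le_card (filter_subset_filter _ h)

theorem sum_comp_eq_sum_load_mul [DecidableEq B] {R : Type*} [CommSemiring R]
    (X : Finset A) (f : A → B) (N : Finset B) (h : ∀ a ∈ X, f a ∈ N) (φ : B → R) :
    ∑ a ∈ X, φ (f a) = ∑ b ∈ N, (load X f b : R) * φ b := by
  rw [← sum_fiberwise_of_maps_to h]
  refine sum_congr rfl fun b _ => ?_
  rw [sum_congr rfl (g := fun _ => φ b) fun a ha => by rw [(mem_filter.mp ha).2]]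
  simp [load]

theorem sum_load [DecidableEq B] (X : Finset A) (f : A → B) (N : Finset B)
    (h : ∀ a ∈ X, f a ∈ N) : ∑ b ∈ N, load X f b = #X := by
  simpa using (sum_comp_eq_sum_load_mul X f N h (fun _ => (1 : ℕ))).symm

/-- If `g` has load at most `d` on `X`, then `f` is loaded at the partners under `g` of the
vertices of `X` by at most `d` times its total load. -/
theorem sum_load_comp_le [DecidableEq B] [Fintype B] {X A₀ : Finset A} (f g : A → B) {d : ℕ} (hd : ∀ b, load X g b ≤ d) :
    ∑ a ∈ X, load A₀ f (g a) ≤ d * #A₀ := by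
  have h := sum_comp_eq_sum_load_mul X g univ (fun _ _ => mem_univ _) (load A₀ f)
  simp only [Nat.cast_id] at h
  rw [h, ← sum_load A₀ f univ fun _ _ => mem_univ _, mul_sum]
  exact sum_le_sum fun b _ => Nat.mul_le_mul_right _ (hd b)

/-- Telescoping: rerouting along a path changes the loads only at its two ends. -/
theorem sum_eq_of_path [DecidableEq A] {f f' : A → B} {k : ℕ} {a : Fin k → A} {b : Fin (k + 1) → B}
    (ha : Function.Injective a) (h₁ : ∀ i, f (a i) = b i.castSucc)
    (h₂ : ∀ i, f' (a i) = b i.succ) (h₃ : ∀ x, x ∉ Set.range a → f' x = f x)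
    {A' : Finset A} (hA : ∀ i, a i ∈ A') (φ : B → ℤ) :
    ∑ x ∈ A', φ (f' x) = ∑ x ∈ A', φ (f x) + φ (b (Fin.last k)) - φ (b 0) := by
  have e : ∑ x ∈ A', (φ (f' x) - φ (f x)) = ∑ i : Fin k, (φ (b i.succ) - φ (b i.castSucc)) := by
    have : ∑ x ∈ univ.image a, (φ (f' x) - φ (f x)) = ∑ x ∈ A', (φ (f' x) - φ (f x)) := by
      refine sum_subset (fun x hx => ?_) fun x _ hx => ?_
      · obtain ⟨i, -, rfl⟩ := mem_image.mp hx
        exact hA i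
      · rw [h₃ x (by rintro ⟨i, rfl⟩; exact hx (mem_image_of_mem _ (mem_univ i))), sub_self]
    rw [← this, sum_image ha.injOn]
    exact sum_congr rfl fun i _ => by rw [h₁, h₂]
  have t : ∑ i : Fin k, (φ (b i.succ) - φ (b i.castSucc)) = φ (b (Fin.last k)) - φ (b 0) := by
    have h4 := Fin.sum_univ_succ fun i => φ (b i)
    have h5 := Fin.sum_univ_castSucc fun i => φ (b i)
    rw [sum_sub_distrib]
    linarith
  rw [sum_sub_distrib] at e
  linarith

/-- If the new head already occurs in the chain, the detour back to it is cut off. -/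
theorem exists_nodup_isChain {r : B → B → Prop} {x y : B} (h : Relation.ReflTransGen r x y) :
    ∃ l : List B, (x :: l).Nodup ∧ (x :: l).IsChain r ∧ (x :: l).getLast (by simp) = y := by
  induction h using Relation.ReflTransGen.head_induction_on with
  | refl => exact ⟨[], by simp, by simp, rfl⟩
  | @head x z hxz _ ih =>
    obtain ⟨l, hn, hc, hl⟩ := ih
    by_cases hx : x ∈ z :: l
    · obtain ⟨s, t, hst⟩ := List.append_of_mem hx
      have hsuf : (x :: t) <:+ (z :: l) := ⟨s, hst.symm⟩
      refine ⟨t, hn.sublist hsuf.sublist, hc.suffix hsuf, ?_⟩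
      rw [← hl, hsuf.getLast]
    · exact ⟨z :: l, List.nodup_cons.mpr ⟨hx, hn⟩, List.isChain_cons_cons.mpr ⟨hxz, hc⟩, hl⟩

section

variable [DecidableEq A] [DecidableEq B]

@[simp]
theorem mem_graphOn {A' : Finset A} {f : A → B} {e : A × B} :
    e ∈ graphOn A' f ↔ e.1 ∈ A' ∧ f e.1 = e.2 := by
  obtain ⟨a, b⟩ := e
  simp only [graphOn, mem_image, Prod.mk.injEq]
  constructor
  · rintro ⟨x, hx, rfl, rfl⟩
    exact ⟨hx, rfl⟩
  · rintro ⟨h, rfl⟩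
    exact ⟨a, h, rfl, rfl⟩

theorem card_graphOn_le (A' : Finset A) (f : A → B) : #(graphOn A' f) ≤ #A' := card_image_le

theorem degB_graphOn (A' : Finset A) (f : A → B) (b : B) :
    degB (graphOn A' f) b = load A' f b := by
  have : (graphOn A' f).filter (fun e => e.2 = b) =
      ({a ∈ A' | f a = b} : Finset A).image fun a => (a, f a) := by
    ext ⟨x, y⟩
    simp only [mem_filter, mem_graphOn, mem_image, Prod.mk.injEq]
    grind
  rw [degB, this, card_image_of_injective _ fun x y h => (Prod.mk.inj h).1, load]

theorem degA_graphOn {A' : Finset A} (f : A → B) {a : A} (ha : a ∈ A') :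
    degA (graphOn A' f) a = 1 := by
  rw [degA, card_eq_one]
  refine ⟨(a, f a), ?_⟩
  ext ⟨x, y⟩
  simp only [mem_filter, mem_graphOn, mem_singleton, Prod.mk.injEq]
  grind

theorem degA_graphOn_of_notMem {A' : Finset A} (f : A → B) {a : A} (ha : a ∉ A') :
    degA (graphOn A' f) a = 0 := by
  rw [degA, card_eq_zero, filter_eq_empty_iff]
  rintro ⟨x, y⟩ h rfl
  exact ha (mem_graphOn.mp h).1

theorem isSemiMatching_graphOn {A' : Finset A} {E : Finset (A × B)} {f : A → B} :
    IsSemiMatching A' E (graphOn A' f) ↔ ∀ a ∈ A', (a, f a) ∈ E := by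
  refine ⟨fun h a ha => ?_, fun h => ⟨?_, fun a ha => degA_graphOn f ha⟩⟩
  · exact (mem_filter.mp (h.1 (mem_graphOn.mpr ⟨ha, rfl⟩))).1
  · rintro ⟨a, b⟩ he
    obtain ⟨ha, hb⟩ := mem_graphOn.mp he
    have := h a ha
    rw [show f a = b from hb] at this
    exact mem_filter.mpr ⟨this, ha⟩

theorem IsSemiMatching.exists_eq_graphOn [Nonempty B] {A' : Finset A} {E S : Finset (A × B)}
    (h : IsSemiMatching A' E S) : ∃ f : A → B, S = graphOn A' f := by
  have key : ∀ a, ∃ b, a ∈ A' → ∀ y, (a, y) ∈ S ↔ b = y := by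
    intro a
    by_cases ha : a ∈ A'
    · obtain ⟨⟨x, b⟩, hx⟩ := card_eq_one.mp (h.2 a ha)
      refine ⟨b, fun _ y => ?_⟩
      have h1 : (x, b) ∈ S.filter fun e => e.1 = a := by rw [hx]; exact mem_singleton_self _
      have h2 : (a, y) ∈ S.filter (fun e => e.1 = a) ↔ (a, y) = (x, b) := by
        rw [hx, mem_singleton]
      simp only [mem_filter, Prod.mk.injEq] at h1 h2
      grind
    · exact ⟨Classical.arbitrary B, fun h => (ha h).elim⟩
  choose f hf using key
  refine ⟨f, ?_⟩
  ext ⟨a, b⟩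
  rw [mem_graphOn]
  refine ⟨fun hab => ?_, fun hab => (hf a hab.1 b).mpr hab.2⟩
  have ha : a ∈ A' := (mem_filter.mp (h.1 hab)).2
  exact ⟨ha, (hf a ha b).mp hab⟩

variable [Fintype A] [Fintype B]

theorem degMax_graphOn_le {A' : Finset A} {f : A → B} {D : ℕ} :
    degMax (graphOn A' f) ≤ D ↔ ∀ b, load A' f b ≤ D := by
  simp only [degMax, max_le_iff, Finset.sup_le_iff, mem_univ, true_imp_iff, degB_graphOn]
  refine ⟨And.right, fun h => ⟨fun a => ?_, h⟩⟩
  by_cases ha : a ∈ A'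
  · rw [degA_graphOn f ha]
    refine le_trans ?_ (h (f a))
    exact card_pos.mpr ⟨a, mem_filter.mpr ⟨ha, rfl⟩⟩
  · rw [degA_graphOn_of_notMem f ha]
    exact Nat.zero_le _

theorem load_le_degMax (A' : Finset A) (f : A → B) (b : B) :
    load A' f b ≤ degMax (graphOn A' f) := degMax_graphOn_le.mp le_rfl b

theorem degMax_graphOn_le_real {A' : Finset A} {f : A → B} {r : ℝ} (hr : 0 ≤ r)
    (h : ∀ b, (load A' f b : ℝ) ≤ r) : (degMax (graphOn A' f) : ℝ) ≤ r := by
  rw [← Nat.le_floor_iff hr, degMax_graphOn_le]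
  exact fun b => Nat.le_floor (h b)

theorem one_le_degMax_graphOn {A' : Finset A} (f : A → B) (h : A'.Nonempty) :
    1 ≤ degMax (graphOn A' f) := by
  obtain ⟨a, ha⟩ := h
  exact (card_pos.mpr ⟨a, mem_filter.mpr ⟨ha, rfl⟩⟩ : 0 < load A' f (f a)).trans_le
    (load_le_degMax A' f (f a))

/-! ### Existence and load properties of optimal semi-matchings -/

/-- A minimiser of the sum of squared loads is optimal: switching along a degree-minimizing path
moves one unit to a vertex with load smaller by at least two, which lowers that sum. -/
theorem exists_isOptimal [Nonempty B] {A' : Finset A} {E S : Finset (A × B)}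
    (hS : IsSemiMatching A' E S) : ∃ f : A → B, IsOptimal A' E (graphOn A' f) := by
  obtain ⟨f₀, rfl⟩ := hS.exists_eq_graphOn
  obtain ⟨f, hf, hmin⟩ := exists_min_image
    (univ.filter fun f : A → B => ∀ a ∈ A', (a, f a) ∈ E)
    (fun f => ∑ b, (load A' f b : ℤ) ^ 2)
    ⟨f₀, mem_filter.mpr ⟨mem_univ _, isSemiMatching_graphOn.mp hS⟩⟩
  simp only [mem_filter, mem_univ, true_and] at hf hmin
  refine ⟨f, isSemiMatching_graphOn.mpr hf, ⟨fun p => ?_⟩⟩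
  -- The extension is `f` switched along the path.
  have hf' : ∀ i, Function.extend p.a (fun i => p.b i.succ) f (p.a i) = p.b i.succ :=
    fun i => p.a_injective.extend_apply _ _ i
  have hf'' : ∀ x, x ∉ Set.range p.a → Function.extend p.a (fun i => p.b i.succ) f x = f x :=
    fun x hx => Function.extend_apply' _ _ _ hx
  generalize Function.extend p.a (fun i => p.b i.succ) f = f' at hf' hf''
  have hA : ∀ i, p.a i ∈ A' := fun i => (mem_graphOn.mp (p.mem_S i)).1
  have hl : ∀ b, (load A' f' b : ℤ) =
      load A' f b + (if p.b (Fin.last _) = b then 1 else 0) - (if p.b 0 = b then 1 else 0) := by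
    intro b
    have := sum_eq_of_path p.a_injective (fun i => (mem_graphOn.mp (p.mem_S i)).2) hf' hf'' hA
      (fun x => if x = b then 1 else 0)
    simpa only [load, card_filter, Nat.cast_sum, Nat.cast_ite, Nat.cast_one, Nat.cast_zero]
      using this
  have hlt := p.deg_lt
  simp only [degB_graphOn] at hlt
  have hne : p.b (Fin.last _) ≠ p.b 0 := fun h => by rw [h] at hlt; omega
  have hle := hmin f' fun a ha => by
    by_cases h : a ∈ Set.range p.a
    · obtain ⟨i, rfl⟩ := h
      rw [hf']
      exact (mem_filter.mp (p.mem_E i)).1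
    · rw [hf'' a h]
      exact hf a ha
  have hsum : ∑ b, (load A' f' b : ℤ) ^ 2 = ∑ b, ((load A' f b : ℤ) ^ 2 +
      (if p.b (Fin.last _) = b then 2 * (load A' f b : ℤ) + 1 else 0) +
      (if p.b 0 = b then 1 - 2 * (load A' f b : ℤ) else 0)) := by
    refine sum_congr rfl fun b _ => ?_
    rw [hl]
    split_ifs with h1 h2
    · exact (hne (h1.trans h2.symm)).elim
    all_goals ring
  rw [hsum, sum_add_distrib, sum_add_distrib] at hle
  simp only [sum_ite_eq, mem_univ, if_true] at hle
  zify at hlt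
  linarith

end

/-- `y` is a possible other partner of a vertex that `f` assigns to `x`. -/
def Reassign (A' : Finset A) (E : Finset (A × B)) (f : A → B) (x y : B) : Prop :=
  ∃ a ∈ A', f a = x ∧ (a, y) ∈ E

section

variable [DecidableEq A] [DecidableEq B]

/-- A larger drop would, after shortening the walk to a simple one, yield a degree-minimizing path.
Distinctness of the `B`-vertices forces that of the `A`-vertices, since `f` recovers the former from
the latter. -/
theorem IsOptimal.load_le_of_reachable {A' : Finset A} {E : Finset (A × B)} {f : A → B}
    (h : IsOptimal A' E (graphOn A' f)) {x y : B}
    (hxy : Relation.ReflTransGen (Reassign A' E f) x y) : load A' f x ≤ load A' f y + 1 := by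
  by_contra! hlt
  obtain ⟨l, hn, hc, hl⟩ := exists_nodup_isChain hxy
  rw [List.isChain_iff_getElem] at hc
  have hc' : ∀ i : Fin l.length, Reassign A' E f ((x :: l)[(i : ℕ)]'(i.2.trans (by simp)))
      ((x :: l)[(i : ℕ) + 1]'(by simp)) := fun i => hc i (by simp)
  choose a ha hfa hae using hc'
  have hb : Function.Injective fun i : Fin (l.length + 1) => (x :: l)[(i : ℕ)]'(by simp; omega) :=
    fun i j hij => Fin.ext ((List.Nodup.getElem_inj_iff hn).mp hij)
  refine h.2.elim
    { k := l.length
      b := fun i => (x :: l)[(i : ℕ)]'(by simp; omega)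
      a := a
      b_injective := hb
      a_injective := fun i j hij => ?_
      mem_S := fun i => mem_graphOn.mpr ⟨ha i, hfa i⟩
      mem_E := fun i => mem_filter.mpr ⟨hae i, ha i⟩
      not_mem_S := fun i hi => ?_
      deg_lt := ?_ }
  · have := hfa i
    rw [hij, hfa j] at this
    exact Fin.ext ((List.Nodup.getElem_inj_iff hn).mp this).symm
  · have := (mem_graphOn.mp hi).2
    simp only [hfa] at this
    have := (List.Nodup.getElem_inj_iff hn).mp this
    simp at this
  · rw [degB_graphOn, degB_graphOn]
    have : (x :: l)[l.length]'(by simp) = y := by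
      rw [← hl, List.getLast_eq_getElem]
      simp
    simp only [Fin.val_last, this]
    exact hlt

theorem IsOptimal.load_le {A' : Finset A} {E : Finset (A × B)} {f : A → B}
    (h : IsOptimal A' E (graphOn A' f)) {a : A} (ha : a ∈ A') {b : B} (hb : (a, b) ∈ E) :
    load A' f (f a) ≤ load A' f b + 1 :=
  h.load_le_of_reachable (.single ⟨a, ha, rfl, hb⟩)

variable [Fintype A] [Fintype B]

/-- An optimal semi-matching minimises the maximal degree. -/
theorem IsOptimal.degMax_le {A' : Finset A} {E : Finset (A × B)} {f g : A → B}
    (h : IsOptimal A' E (graphOn A' f)) (hg : ∀ a ∈ A', (a, g a) ∈ E) :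
    degMax (graphOn A' f) ≤ degMax (graphOn A' g) := by
  classical
  refine degMax_graphOn_le.mpr fun b => ?_
  -- `R` is closed under moves, so `g` maps the vertices that `f` sends to `R` back into `R`. If `b`
  -- had load above the degree of `g`, every load on `R` would be at least that degree, and strictly
  -- more at `b`: too many vertices for `g`.
  let R : Finset B := univ.filter fun y => Relation.ReflTransGen (Reassign A' E f) b y
  let X : Finset A := A'.filter fun a => f a ∈ R
  have hX : ∀ a ∈ X, g a ∈ R := fun a ha => by
    obtain ⟨ha, hR⟩ := mem_filter.mp ha
    exact mem_filter.mpr ⟨mem_univ _, (mem_filter.mp hR).2.tail ⟨a, ha, rfl, hg a ha⟩⟩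
  have hfX : ∀ y ∈ R, load X f y = load A' f y := fun y hy => by
    unfold load
    congr 1
    ext a
    simp only [X, mem_filter]
    grind
  have hbR : b ∈ R := mem_filter.mpr ⟨mem_univ _, .refl⟩
  have h1 : #X = ∑ y ∈ R, load A' f y := by
    rw [← sum_congr rfl hfX, sum_load X f R fun a ha => (mem_filter.mp ha).2]
  have h2 : #X ≤ ∑ _y ∈ R, degMax (graphOn A' g) := by
    rw [← sum_load X g R hX]
    exact sum_le_sum fun y _ => (load_mono (filter_subset _ _) g y).trans (load_le_degMax A' g y)
  by_contra! hlt
  refine absurd h2 (not_le.mpr ?_)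
  rw [h1]
  refine sum_lt_sum (fun y hy => ?_) ⟨b, hbR, hlt⟩
  have := h.load_le_of_reachable (mem_filter.mp hy).2
  omega

end

end

/-! ### Skeletons from one optimal semi-matching -/

section

variable {A : Type u} {B : Type v}

section

variable [DecidableEq A]

/-- The vertices of `A` with an incident edge in `E`. -/
def matchable (E : Finset (A × B)) : Finset A := E.image Prod.fst

theorem mem_matchable {E : Finset (A × B)} {a : A} : a ∈ matchable E ↔ ∃ b, (a, b) ∈ E := by
  simp [matchable]

variable [DecidableEq B]

theorem exists_isOptimal_of_subset_matchable [Fintype A] [Fintype B] [Nonempty B] {X : Finset A}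
    {E : Finset (A × B)} (hX : X ⊆ matchable E) : ∃ f : A → B, IsOptimal X E (graphOn X f) := by
  have : ∀ a, ∃ b, a ∈ X → (a, b) ∈ E := fun a => by
    by_cases ha : a ∈ X
    · obtain ⟨b, hb⟩ := mem_matchable.mp (hX ha)
      exact ⟨b, fun _ => hb⟩
    · exact ⟨Classical.arbitrary B, fun h => (ha h).elim⟩
  choose f hf using this
  exact exists_isOptimal (isSemiMatching_graphOn.mpr hf)

/-- To prove the skeleton property it suffices to find, for every semi-matching of `X` in `E`,
a semi-matching of `X` in `S` of comparable load. -/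
theorem isSkeleton_of_forall_exists [Fintype A] [Fintype B] [Nonempty B] {γ : ℝ} (hγ : 0 ≤ γ)
    {E S : Finset (A × B)} (hS : S ⊆ E)
    (h : ∀ (X : Finset A) (g : A → B), X.Nonempty → (∀ a ∈ X, (a, g a) ∈ E) →
      ∃ f : A → B, (∀ a ∈ X, (a, f a) ∈ S) ∧
        ∀ b, (load X f b : ℝ) ≤ γ * (degMax (graphOn X g) : ℝ)) :
    IsSkeleton γ E S := by
  refine ⟨hS, fun X T hT => ?_⟩
  obtain ⟨g, rfl⟩ := hT.1.exists_eq_graphOn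
  have : ∃ f : A → B, (∀ a ∈ X, (a, f a) ∈ S) ∧
      ∀ b, (load X f b : ℝ) ≤ γ * (degMax (graphOn X g) : ℝ) := by
    obtain rfl | hX := X.eq_empty_or_nonempty
    · exact ⟨g, by simp, fun b => by simpa [load] using by positivity⟩
    · exact h X g hX (isSemiMatching_graphOn.mp hT.1)
  obtain ⟨f, hfS, hf⟩ := this
  obtain ⟨f', hf'⟩ := exists_isOptimal (isSemiMatching_graphOn.mpr hfS)
  exact ⟨_, hf', (Nat.cast_le.mpr (hf'.degMax_le hfS)).trans
    (degMax_graphOn_le_real (by positivity) hf)⟩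

theorem IsOptimal.sum_load_le [Fintype B] {A₀ X : Finset A} {E : Finset (A × B)} {f g : A → B}
    (hf : IsOptimal A₀ E (graphOn A₀ f)) (hX : X ⊆ A₀) (hg : ∀ a ∈ X, (a, g a) ∈ E) {d : ℕ}
    (hd : ∀ b, load X g b ≤ d) : ∑ a ∈ X, load A₀ f (f a) ≤ d * #A₀ + #X := by
  refine (sum_le_sum fun a ha => hf.load_le (hX ha) (hg a ha)).trans ?_
  rw [sum_add_distrib]
  simpa using sum_load_comp_le f g hd

/-- A function form of Hall's theorem for semi-matchings of load at most `D`. -/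
theorem exists_load_le_of_card_le {X : Finset A} {D : ℕ} (N : A → Finset B)
    [Nonempty B] (h : ∀ Y ⊆ X, #Y ≤ D * #(Y.biUnion N)) :
    ∃ f : A → B, (∀ a ∈ X, f a ∈ N a) ∧ ∀ b, load X f b ≤ D := by
  -- Hall's theorem is applied with `D` copies of every vertex of `B`.
  obtain ⟨F, hF, hFN⟩ := (all_card_le_biUnion_card_iff_exists_injective
    (fun a : X => N a ×ˢ (univ : Finset (Fin D)))).mp fun Y => by
      have h1 := h (Y.map (Function.Embedding.subtype _)) fun a ha => by
        obtain ⟨y, -, rfl⟩ := mem_map.mp ha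
        exact y.2
      have h2 : (Y.biUnion fun a : X => N a ×ˢ (univ : Finset (Fin D))) =
          ((Y.map (Function.Embedding.subtype _)).biUnion N) ×ˢ (univ : Finset (Fin D)) := by
        ext ⟨b, i⟩
        simp
      rw [h2, card_product, card_univ, Fintype.card_fin, mul_comm]
      rwa [card_map] at h1
  refine ⟨fun a => if ha : a ∈ X then (F ⟨a, ha⟩).1 else Classical.arbitrary B,
    fun a ha => ?_, fun b => ?_⟩
  · simp only [ha, dif_pos]
    exact (mem_product.mp (hFN ⟨a, ha⟩)).1
  · rw [load, ← card_attach]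
    refine (card_le_card_of_injOn (t := (univ : Finset (Fin D))) (fun a => (F ⟨a.1, (mem_filter.mp a.2).1⟩).2)
      (fun _ _ => mem_univ _) fun a _ c _ hac => ?_).trans_eq (by simp)
    have ha := mem_filter.mp a.2
    have hc := mem_filter.mp c.2
    simp only [ha.1, hc.1, dif_pos] at ha hc
    have := hF (Prod.ext (ha.2.trans hc.2.symm) hac)
    exact Subtype.ext (Subtype.mk.inj this)

variable [Fintype A] [Fintype B]

theorem IsOptimal.isSkeleton_graphOn [Nonempty B] {E : Finset (A × B)} {f : A → B}
    (hf : IsOptimal (matchable E) E (graphOn (matchable E) f)) :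
    IsSkeleton ((Fintype.card A : ℝ) ^ (1 / 2 : ℝ) + 1) E (graphOn (matchable E) f) := by
  rw [← Real.sqrt_eq_rpow]
  set n := Fintype.card A
  refine isSkeleton_of_forall_exists (by positivity)
    (fun e he => (mem_filter.mp (hf.1.1 he)).1) fun X g hX hg => ?_
  have hXA : X ⊆ matchable E := fun a ha => mem_matchable.mpr ⟨_, hg a ha⟩
  refine ⟨f, fun a ha => mem_graphOn.mpr ⟨hXA ha, rfl⟩, fun b => ?_⟩
  have hd1 := one_le_degMax_graphOn g hX
  have hd := load_le_degMax X g
  generalize degMax (graphOn X g) = d at hd hd1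
  let Y : Finset A := {a ∈ X | f a = b}
  have hYX : Y ⊆ X := filter_subset _ _
  have h1 := hf.sum_load_le (hYX.trans hXA) (fun a ha => hg a (hYX ha))
    (fun z => (load_mono hYX g z).trans (hd z))
  have h2 : #Y * load X f b ≤ ∑ a ∈ Y, load (matchable E) f (f a) := by
    rw [← smul_eq_mul]
    refine card_nsmul_le_sum _ _ _ fun a ha => ?_
    rw [(mem_filter.mp ha).2]
    exact load_mono hXA f b
  have h3 : #(matchable E) ≤ n := card_le_univ _
  have h4 : load X f b * load X f b ≤ d * n + load X f b :=
    (h2.trans h1).trans (Nat.add_le_add_right (Nat.mul_le_mul_left _ h3) _)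
  generalize load X f b = s at h4
  have h5 : (s : ℝ) * s ≤ d * n + s := by exact_mod_cast h4
  have hd1' : (1 : ℝ) ≤ d := by exact_mod_cast hd1
  have hr := Real.sqrt_nonneg (n : ℝ)
  have hn := Real.mul_self_sqrt (Nat.cast_nonneg (α := ℝ) n)
  by_contra! hlt
  have h6 : √(n : ℝ) * d < s - 1 := by nlinarith
  have h7 : √(n : ℝ) * d ≤ s := by linarith
  have h8 : 0 ≤ √(n : ℝ) * d := by positivity
  have h9 : (√(n : ℝ) * d + 1) * (√(n : ℝ) * d) < s * (s - 1) :=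
    mul_lt_mul'' (by linarith) h6 (by positivity) h8
  have h10 : √(n : ℝ) * d * (√(n : ℝ) * d) = n * d * d := by
    rw [mul_mul_mul_comm, hn, mul_assoc]
  have h11 : (n : ℝ) * d ≤ n * d * d := le_mul_of_one_le_right (by positivity) hd1'
  linarith

end

/-! ### Skeletons from two levels of optimal semi-matchings -/

/-- Suppose the mean `M` of `s` exceeds `2td`, and let `k = #N`. Convexity of the square and `h₁`
give `kM(M - 1) ≤ dt³`, so `2k ≤ t`. Multiplying `h₂` by `s i`, summing, and bounding `s³ - ks²`
below by its tangent at `M` gives `M³ - kM² ≤ d(dt³ + kM)`, which is impossible for such `M` and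
`k`. -/
theorem sum_le_of_load_inequalities {ι : Type*} (N : Finset ι) (s D : ι → ℝ) {d t : ℝ}
    (hd : 1 ≤ d) (ht : 1 ≤ t) (hs : ∀ i ∈ N, 0 ≤ s i) (hsD : ∀ i ∈ N, s i ≤ D i)
    (h₁ : ∑ i ∈ N, s i * D i ≤ d * t ^ 3 + ∑ i ∈ N, s i)
    (h₂ : ∀ i ∈ N, s i ^ 2 ≤ #N * (d * D i + s i)) :
    ∑ i ∈ N, s i ≤ 2 * t * d * #N := by
  by_contra! hlt
  obtain rfl | hN := N.eq_empty_or_nonempty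
  · simp at hlt
  have hk : (0 : ℝ) < #N := by exact_mod_cast hN.card_pos
  generalize hkk : (#N : ℝ) = k at *
  obtain ⟨M, hM⟩ : ∃ M, ∑ i ∈ N, s i = k * M := ⟨(∑ i ∈ N, s i) / k, by field_simp⟩
  rw [hM] at hlt h₁
  have hM' : 2 * t * d < M := by nlinarith
  have htd : 1 ≤ t * d := one_le_mul_of_one_le_of_one_le ht hd
  have hsq : k * M ^ 2 ≤ ∑ i ∈ N, s i * D i := by
    have h : ∑ i ∈ N, (2 * M * s i - M ^ 2) ≤ ∑ i ∈ N, s i * D i :=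
      sum_le_sum fun i hi => by
        nlinarith [sq_nonneg (s i - M), mul_le_mul_of_nonneg_left (hsD i hi) (hs i hi)]
    rw [sum_sub_distrib, ← mul_sum, hM, sum_const, nsmul_eq_mul, hkk] at h
    linarith
  have hkt : 2 * k ≤ t := by
    have h1 : k * (M * (M - 1)) ≤ d * t ^ 3 := by nlinarith
    have h2 : (2 * t * d) * (t * d) ≤ M * (M - 1) :=
      mul_le_mul hM'.le (by linarith) (by positivity) (by linarith)
    have h3 : k * ((2 * t * d) * (t * d)) ≤ d * t ^ 3 :=
      (mul_le_mul_of_nonneg_left h2 hk.le).trans h1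
    have h4 : (d * t ^ 2) * (2 * k * d) ≤ (d * t ^ 2) * t := by nlinarith
    have h5 : 2 * k * d ≤ t := le_of_mul_le_mul_left h4 (by positivity)
    nlinarith
  have hcube : k * (M ^ 3 - k * M ^ 2) ≤ ∑ i ∈ N, k * (d * (s i * D i)) := by
    have h : ∑ i ∈ N, (M ^ 3 - k * M ^ 2 + (3 * M ^ 2 - 2 * k * M) * (s i - M)) ≤
        ∑ i ∈ N, k * (d * (s i * D i)) := by
      refine sum_le_sum fun i hi => ?_
      have h1 := mul_le_mul_of_nonneg_left (h₂ i hi) (hs i hi)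
      have h2 : 0 ≤ (s i - M) ^ 2 * (s i + (2 * M - k)) :=
        mul_nonneg (sq_nonneg _) (add_nonneg (hs i hi) (by nlinarith))
      nlinarith
    rw [sum_add_distrib, ← mul_sum, sum_sub_distrib, sum_sub_distrib, hM, sum_const, sum_const, sum_const,
      nsmul_eq_mul, nsmul_eq_mul, nsmul_eq_mul, hkk] at h
    linarith
  rw [← mul_sum, ← mul_sum] at hcube
  have h6 : M ^ 3 - k * M ^ 2 ≤ d * (d * t ^ 3 + k * M) :=
    (le_of_mul_le_mul_left hcube hk).trans (mul_le_mul_of_nonneg_left h₁ (by linarith))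
  have hMk : 3 / 2 * (t * d) ≤ M - k := by nlinarith
  have h7 : (2 * t * d) * (3 / 2 * (t * d)) ≤ M * (M - k) :=
    mul_le_mul hM'.le hMk (by positivity) (by linarith)
  have h8 : k * d ≤ t * d * (t * d) / 2 := by nlinarith
  have h9 : (2 * t * d) * (5 / 2 * (t * d) ^ 2) ≤ M * (M * (M - k) - k * d) :=
    mul_le_mul hM'.le (by nlinarith) (by positivity) (by linarith)
  have h10 : d ^ 2 * t ^ 3 ≤ (t * d) ^ 3 := by
    have : 0 ≤ d ^ 2 * t ^ 3 * (d - 1) := mul_nonneg (by positivity) (by linarith)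
    nlinarith
  have h11 : 0 < (t * d) ^ 3 := by positivity
  nlinarith

end

theorem card_partial_maps_le {A : Type u} {B : Type v} [Fintype A] [DecidableEq A]
    [Fintype B] :
    Fintype.card (A → Option B) ≤ 2 ^ (Fintype.card A * (Nat.log 2 (Fintype.card B) + 1)) := by
  rw [Fintype.card_fun, Fintype.card_option, mul_comm, pow_mul]
  exact Nat.pow_le_pow_left (Nat.lt_pow_succ_log_self one_lt_two _) _

variable {A : Type u} {B : Type v}
  [Fintype A] [DecidableEq A] [Fintype B] [DecidableEq B]

theorem IsOptimal.isSkeleton_union_graphOn [Nonempty B] {E : Finset (A × B)} {f : A → B}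
    {G : B → A → B} (hf : IsOptimal (matchable E) E (graphOn (matchable E) f))
    (hG : ∀ b, IsOptimal {a ∈ matchable E | f a = b} E
      (graphOn {a ∈ matchable E | f a = b} (G b))) :
    IsSkeleton (2 * (Fintype.card A : ℝ) ^ (1 / 3 : ℝ) + 1) E
      (graphOn (matchable E) f ∪ graphOn (matchable E) fun a => G (f a) a) := by
  have hfE := isSemiMatching_graphOn.mp hf.1
  have hGE : ∀ a ∈ matchable E, (a, G (f a) a) ∈ E := fun a ha =>
    isSemiMatching_graphOn.mp (hG (f a)).1 a (mem_filter.mpr ⟨ha, rfl⟩)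
  set n := Fintype.card A
  refine isSkeleton_of_forall_exists (by positivity) ?_ fun X g hX hg => ?_
  · rintro ⟨a, b⟩ he
    obtain he | he := mem_union.mp he
    · obtain ⟨ha, hb⟩ := mem_graphOn.mp he
      have := hfE a ha
      rwa [show f a = b from hb] at this
    · obtain ⟨ha, hb⟩ := mem_graphOn.mp he
      have := hGE a ha
      rwa [show G (f a) a = b from hb] at this
  have hXA : X ⊆ matchable E := fun a ha => mem_matchable.mpr ⟨_, hg a ha⟩
  have hd1 := one_le_degMax_graphOn g hX
  have hd := load_le_degMax X g
  generalize degMax (graphOn X g) = d at hd hd1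
  have hd1' : (1 : ℝ) ≤ d := by exact_mod_cast hd1
  have hn : 1 ≤ n := Fintype.card_pos_iff.mpr ⟨hX.choose⟩
  have ht : (1 : ℝ) ≤ (n : ℝ) ^ (1 / 3 : ℝ) :=
    Real.one_le_rpow (by exact_mod_cast hn) (by norm_num)
  have ht3 : ((n : ℝ) ^ (1 / 3 : ℝ)) ^ 3 = n := by
    rw [← Real.rpow_natCast, ← Real.rpow_mul (Nat.cast_nonneg _)]
    norm_num
  generalize (n : ℝ) ^ (1 / 3 : ℝ) = t at ht ht3
  -- Since `d ≥ 1`, the extra `d` beyond `2td` absorbs the rounding down.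
  obtain ⟨f', hf', hload⟩ := exists_load_le_of_card_le (X := X) (D := ⌊(2 * t + 1) * (d : ℝ)⌋₊)
    (fun a => {f a, G (f a) a}) fun Y hYX => by
      set N : Finset B := Y.biUnion fun a => {f a, G (f a) a} with hN
      have hfN : ∀ a ∈ Y, f a ∈ N := fun a ha => mem_biUnion.mpr ⟨a, ha, by simp⟩
      have hGN : ∀ a ∈ Y, G (f a) a ∈ N := fun a ha => mem_biUnion.mpr ⟨a, ha, by simp⟩
      have hYA : Y ⊆ matchable E := hYX.trans hXA
      have hs : ∑ b ∈ N, (load Y f b : ℝ) = #Y := by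
        exact_mod_cast sum_load Y f N hfN
      have key := sum_le_of_load_inequalities N (fun b => (load Y f b : ℝ))
        (fun b => (load (matchable E) f b : ℝ)) hd1' ht (fun _ _ => Nat.cast_nonneg _)
        (fun b _ => Nat.cast_le.mpr (load_mono hYA f b)) ?_ fun b _ => ?_
      · rw [hs] at key
        have h1 : 2 * t * d ≤ (⌊(2 * t + 1) * (d : ℝ)⌋₊ : ℝ) := by
          have := Nat.lt_floor_add_one ((2 * t + 1) * (d : ℝ))
          nlinarith
        have h2 := key.trans (mul_le_mul_of_nonneg_right h1 (Nat.cast_nonneg _))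
        exact_mod_cast h2
      · rw [ht3, hs, ← sum_comp_eq_sum_load_mul Y f N hfN
          fun b => (load (matchable E) f b : ℝ)]
        have h1 := hf.sum_load_le hYA (fun a ha => hg a (hYX ha))
          (fun z => (load_mono hYX g z).trans (hd z))
        have h2 : #(matchable E) ≤ n := card_le_univ _
        have h3 := h1.trans (Nat.add_le_add_right (Nat.mul_le_mul_left _ h2) _)
        exact_mod_cast h3
      · let Z : Finset A := {a ∈ Y | f a = b}
        have hZY : Z ⊆ Y := filter_subset _ _
        have hZN : ∀ a ∈ Z, G b a ∈ N := fun a ha => by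
          have := hGN a (hZY ha)
          rwa [(mem_filter.mp ha).2] at this
        have hZA : Z ⊆ ({a ∈ matchable E | f a = b} : Finset A) := filter_subset_filter _ hYA
        have h1 := (hG b).sum_load_le hZA (fun a ha => hg a (hYX (hZY ha)))
          (fun z => (load_mono (hZY.trans hYX) g z).trans (hd z))
        have h2 := (sum_le_sum fun a _ => load_mono hZA (G b) (G b a)).trans h1
        have h3 := sum_comp_eq_sum_load_mul Z (G b) N hZN (load Z (G b))
        rw [h3] at h2
        -- Cauchy–Schwarz: the second level spreads the fibre `Z` over at most `#N` partners.
        have h4 := sq_sum_le_card_mul_sum_sq (s := N) (f := load Z (G b))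
        rw [sum_load Z (G b) N hZN] at h4
        simp only [pow_two (load _ _ _)] at h4
        have h5 := h4.trans (Nat.mul_le_mul_left _ h2)
        have h6 : #Z = load Y f b := rfl
        have h7 : #({a ∈ matchable E | f a = b} : Finset A) = load (matchable E) f b := rfl
        rw [h6, h7] at h5
        exact_mod_cast h5
  refine ⟨f', fun a ha => mem_union.mpr ?_, fun b => ?_⟩
  · have := hf' a ha
    rw [mem_insert, mem_singleton] at this
    exact this.imp (fun h => mem_graphOn.mpr ⟨hXA ha, h.symm⟩)
      fun h => mem_graphOn.mpr ⟨hXA ha, h.symm⟩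
  · exact (Nat.cast_le.mpr (hload b)).trans (Nat.floor_le (by positivity))

/-! ### From skeletons to protocols -/

/-- Adding further edges to both a graph and a skeleton of it, an optimal semi-matching of the
sparsified graph is worse than the optimum by at most one more than the skeleton's factor. -/
theorem IsSkeleton.degMax_le [Nonempty B] {γ : ℝ} (hγ : 0 ≤ γ) {E₁ E₂ S : Finset (A × B)}
    (hS : IsSkeleton γ E₁ S) {g : A → B} (hg : ∀ a, (a, g a) ∈ E₁ ∪ E₂) :
    ∃ h : A → B, (∀ a, (a, h a) ∈ S ∪ E₂) ∧
      (degMax (graphOn univ h) : ℝ) ≤ (γ + 1) * degMax (graphOn univ g) := by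
  -- Vertices that `g` matches within `E₁` are rerouted through the skeleton, at cost `γ`; the
  -- others keep their edge, at cost one.
  let X : Finset A := {a | (a, g a) ∈ E₁}
  have hX : ∀ a, a ∈ X ↔ (a, g a) ∈ E₁ := fun a => by simp [X]
  obtain ⟨f, hf⟩ := exists_isOptimal (isSemiMatching_graphOn.mpr fun a ha => (hX a).mp ha)
  obtain ⟨T, hT, hTd⟩ := hS.2 X _ hf
  obtain ⟨p, rfl⟩ := hT.1.exists_eq_graphOn
  have hpS := isSemiMatching_graphOn.mp hT.1
  have hfd : degMax (graphOn X f) ≤ degMax (graphOn univ g) :=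
    (hf.degMax_le fun a ha => (hX a).mp ha).trans <|
      degMax_graphOn_le.mpr fun b => (load_mono (subset_univ _) g b).trans (load_le_degMax _ g b)
  have hdec : ∀ b, load univ (fun a => if a ∈ X then p a else g a) b ≤
      load X p b + load univ g b := fun b => by
    refine (card_le_card fun a ha => ?_).trans (card_union_le _ _)
    by_cases haX : a ∈ X <;> simp_all
  refine ⟨fun a => if a ∈ X then p a else g a, fun a => ?_, ?_⟩
  · by_cases ha : a ∈ X
    · simp only [ha, if_true]
      exact mem_union_left _ (hpS a ha)
    · simp only [ha, if_false]
      exact mem_union_right _ ((mem_union.mp (hg a)).resolve_left fun h => ha ((hX a).mpr h))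
  · have h1 : degMax (graphOn univ fun a => if a ∈ X then p a else g a) ≤
        degMax (graphOn X p) + degMax (graphOn univ g) :=
      degMax_graphOn_le.mpr fun b =>
        (hdec b).trans (add_le_add (load_le_degMax _ _ _) (load_le_degMax _ _ _))
    have h2 : (degMax (graphOn univ fun a => if a ∈ X then p a else g a) : ℝ) ≤
        degMax (graphOn X p) + degMax (graphOn univ g) := by exact_mod_cast h1
    have h3 : (degMax (graphOn X f) : ℝ) ≤ degMax (graphOn univ g) := by exact_mod_cast hfd
    linarith [mul_le_mul_of_nonneg_left h3 hγ]

/-- A family of skeletons that is described by `L` bits yields a one-way protocol. -/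
theorem exists_protocol [Nonempty B] {C : Type*} [Fintype C] (dec : C → Finset (A × B))
    {L N : ℕ} (hC : Fintype.card C ≤ 2 ^ L) {γ : ℝ} (hγ : 0 ≤ γ)
    (h : ∀ E : Finset (A × B), ∃ c, IsSkeleton γ E (dec c) ∧ #(dec c) ≤ N) :
    ∃ P : OneWayProtocol A B, P.bits = L ∧ P.IsApprox (γ + 1) ∧ P.SendsSkeleton N γ := by
  classical
  obtain ⟨enc⟩ : Nonempty (C ↪ (Fin L → Bool)) :=
    Function.Embedding.nonempty_of_card_le (by simpa using hC)
  choose c hc hcN using h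
  have : Nonempty C := ⟨c ∅⟩
  have hinv : ∀ x, Function.invFun enc (enc x) = x := Function.leftInverse_invFun enc.injective
  let read : (Fin L → Bool) → Finset (A × B) := fun w => dec (Function.invFun enc w)
  let P : OneWayProtocol A B :=
    { bits := L
      alice := fun E => enc (c E)
      -- The default `∅` is never reached when the input graph has a semi-matching.
      bob := fun w E => if h : ∃ T, IsOptimal univ (read w ∪ E) T then h.choose else ∅ }
  have hread : ∀ E, read (P.alice E) = dec (c E) := fun E => congrArg dec (hinv _)
  have hkey : ∀ E₁ E₂ : Finset (A × B), ∀ S, IsSemiMatching univ (E₁ ∪ E₂) S →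
      ∃ h : A → B, IsSemiMatching univ (dec (c E₁) ∪ E₂) (graphOn univ h) ∧
        (degMax (graphOn univ h) : ℝ) ≤ (γ + 1) * degMax S := fun E₁ E₂ S hS => by
    obtain ⟨g, rfl⟩ := hS.exists_eq_graphOn
    obtain ⟨q, hq, hqd⟩ := (hc E₁).degMax_le hγ (E₂ := E₂)
      fun a => isSemiMatching_graphOn.mp hS a (mem_univ a)
    exact ⟨q, isSemiMatching_graphOn.mpr fun a _ => hq a, hqd⟩
  have hopt : ∀ E₁ E₂ : Finset (A × B), (∃ S, IsSemiMatching univ (E₁ ∪ E₂) S) →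
      IsOptimal univ (dec (c E₁) ∪ E₂) (P.output E₁ E₂) := fun E₁ E₂ ⟨S, hS⟩ => by
    obtain ⟨q, hq, -⟩ := hkey E₁ E₂ S hS
    obtain ⟨T, hT⟩ := exists_isOptimal hq
    have hex : ∃ T, IsOptimal univ (read (P.alice E₁) ∪ E₂) T := ⟨_, by rw [hread]; exact hT⟩
    have hout : P.output E₁ E₂ = hex.choose := dif_pos hex
    rw [hout, ← hread]
    exact hex.choose_spec
  refine ⟨P, rfl, fun E₁ E₂ hE => ⟨?_, fun S' hS' => ?_⟩, read, fun E => ?_, fun E₁ E₂ hE => ?_⟩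
  · obtain ⟨hsub, hdeg⟩ := (hopt E₁ E₂ hE).1
    exact ⟨hsub.trans (filter_subset_filter _ (union_subset_union_left (hc E₁).1)), hdeg⟩
  · obtain ⟨q, hq, hqd⟩ := hkey E₁ E₂ S' hS'.1
    have ho := hopt E₁ E₂ hE
    obtain ⟨p, hp⟩ := ho.1.exists_eq_graphOn
    rw [hp] at ho ⊢
    exact (Nat.cast_le.mpr (ho.degMax_le (isSemiMatching_graphOn.mp hq))).trans hqd
  · rw [hread]
    exact ⟨hc E, hcN E⟩
  · rw [hread]
    exact hopt E₁ E₂ hE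

/-- The edge set of a partial map from `A` to `B`. -/
def edgesOf (c : A → Option B) : Finset (A × B) := {e | c e.1 = some e.2}

theorem exists_edgesOf_eq_graphOn (X : Finset A) (f : A → B) :
    ∃ c : A → Option B, edgesOf c = graphOn X f := by
  refine ⟨fun a => if a ∈ X then some (f a) else none, ?_⟩
  ext ⟨a, b⟩
  simp [edgesOf]

theorem cast_mul_log_add_one_le {m : ℕ} (hm : 2 ≤ m) (n : ℕ) :
    ((n * (Nat.log 2 m + 1) : ℕ) : ℝ) ≤ 2 * n * Real.logb 2 m := by
  have h1 : (Nat.log 2 m : ℝ) ≤ Real.logb 2 m := by exact_mod_cast Real.natLog_le_logb m 2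
  have h2 : 1 ≤ Real.logb 2 (m : ℝ) := by
    rw [Real.le_logb_iff_rpow_le one_lt_two (by positivity)]
    simpa using (by exact_mod_cast hm : (2 : ℝ) ≤ m)
  push_cast
  nlinarith [Nat.cast_nonneg (α := ℝ) n]

theorem exists_protocol_graphOn (hB : 2 ≤ Fintype.card B) :
    ∃ P : OneWayProtocol A B, P.bits = Fintype.card A * (Nat.log 2 (Fintype.card B) + 1) ∧
      P.IsApprox ((Fintype.card A : ℝ) ^ (1 / 2 : ℝ) + 1 + 1) ∧
      P.SendsSkeleton (Fintype.card A) ((Fintype.card A : ℝ) ^ (1 / 2 : ℝ) + 1) := by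
  have : Nonempty B := Fintype.card_pos_iff.mp (by omega)
  refine exists_protocol edgesOf card_partial_maps_le (by positivity) fun E => ?_
  obtain ⟨f, hf⟩ := exists_isOptimal_of_subset_matchable (subset_refl (matchable E))
  obtain ⟨c, hc⟩ := exists_edgesOf_eq_graphOn (matchable E) f
  refine ⟨c, ?_⟩
  rw [hc]
  exact ⟨hf.isSkeleton_graphOn, (card_graphOn_le _ _).trans (card_le_univ _)⟩

theorem exists_protocol_union_graphOn (hB : 2 ≤ Fintype.card B) :
    ∃ P : OneWayProtocol A B,
      P.bits = 2 * (Fintype.card A * (Nat.log 2 (Fintype.card B) + 1)) ∧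
      P.IsApprox (2 * (Fintype.card A : ℝ) ^ (1 / 3 : ℝ) + 1 + 1) ∧
      P.SendsSkeleton (2 * Fintype.card A) (2 * (Fintype.card A : ℝ) ^ (1 / 3 : ℝ) + 1) := by
  have : Nonempty B := Fintype.card_pos_iff.mp (by omega)
  have hcard : Fintype.card ((A → Option B) × (A → Option B)) ≤
      2 ^ (2 * (Fintype.card A * (Nat.log 2 (Fintype.card B) + 1))) := by
    rw [Fintype.card_prod, two_mul, pow_add]
    exact Nat.mul_le_mul card_partial_maps_le card_partial_maps_le
  refine exists_protocol (fun c => edgesOf c.1 ∪ edgesOf c.2) hcard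
    (by positivity) fun E => ?_
  obtain ⟨f, hf⟩ := exists_isOptimal_of_subset_matchable (subset_refl (matchable E))
  choose G hG using fun b => exists_isOptimal_of_subset_matchable
    (filter_subset (fun a => f a = b) (matchable E))
  obtain ⟨c₁, hc₁⟩ := exists_edgesOf_eq_graphOn (matchable E) f
  obtain ⟨c₂, hc₂⟩ := exists_edgesOf_eq_graphOn (matchable E) fun a => G (f a) a
  refine ⟨(c₁, c₂), ?_⟩
  simp only [hc₁, hc₂]
  refine ⟨hf.isSkeleton_union_graphOn hG, (card_union_le _ _).trans ?_⟩
  rw [two_mul]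
  exact add_le_add ((card_graphOn_le _ _).trans (card_le_univ _))
    ((card_graphOn_le _ _).trans (card_le_univ _))

/-- If `B` has at most one vertex, then Bob needs no message. -/
theorem exists_protocol_of_card_le_one (hB : Fintype.card B ≤ 1) :
    ∃ P : OneWayProtocol A B, P.bits = 0 ∧ ∀ γ : ℝ, 1 ≤ γ → P.IsApprox γ := by
  have := Fintype.card_le_one_iff_subsingleton.mp hB
  refine ⟨⟨0, fun _ => finZeroElim, fun _ _ => univ⟩, rfl, fun γ hγ E₁ E₂ ⟨S, hS⟩ => ?_⟩
  have huniv : ∀ T, IsSemiMatching univ (E₁ ∪ E₂) T → T = univ := fun T hT => by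
    refine eq_univ_of_forall fun ⟨a, b⟩ => ?_
    have h1 : 0 < degA T a := by rw [hT.2 a (mem_univ a)]; exact one_pos
    obtain ⟨⟨x, y⟩, hx⟩ := card_pos.mp h1
    obtain ⟨hx, rfl⟩ := mem_filter.mp hx
    rwa [Subsingleton.elim b y]
  have hout : ∀ P : OneWayProtocol A B, (∀ w E, P.bob w E = univ) → P.output E₁ E₂ = univ :=
    fun P hP => hP _ _
  rw [hout _ fun _ _ => rfl]
  refine ⟨huniv S hS ▸ hS, fun S' hS' => ?_⟩
  rw [huniv S' hS'.1]
  exact le_mul_of_one_le_left (Nat.cast_nonneg _) hγ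

end SemiMatching

theorem theorem4 :
    ∃ c : ℝ, 0 < c ∧
      ∀ (A : Type u) (B : Type v) [Fintype A] [DecidableEq A] [Fintype B] [DecidableEq B]
        (n m : ℕ), Fintype.card A = n → Fintype.card B = m →
        (∃ P : SemiMatching.OneWayProtocol A B,
          (P.bits : ℝ) ≤ c * (n : ℝ) * Real.logb 2 (m : ℝ) ∧
          P.IsApprox ((n : ℝ) ^ (1 / 2 : ℝ) + 2) ∧
          (2 ≤ m → P.SendsSkeleton n ((n : ℝ) ^ (1 / 2 : ℝ) + 1))) ∧
        (∃ P : SemiMatching.OneWayProtocol A B,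
          (P.bits : ℝ) ≤ 2 * c * (n : ℝ) * Real.logb 2 (m : ℝ) ∧
          P.IsApprox (2 * (n : ℝ) ^ (1 / 3 : ℝ) + 2) ∧
          (2 ≤ m → P.SendsSkeleton (2 * n) (2 * (n : ℝ) ^ (1 / 3 : ℝ) + 1))) := by
  -- The factor two turns `⌊log₂ m⌋ + 1` into a multiple of `log₂ m` once `m ≥ 2`. For `m ≤ 1` the
  -- bound is zero bits, hence the separate case.
  refine ⟨2, two_pos, fun A B _ _ _ _ n m hn hm => ?_⟩
  subst hn hm
  obtain hB | hB := le_or_gt 2 (Fintype.card B)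
  · have hbits := SemiMatching.cast_mul_log_add_one_le hB (Fintype.card A)
    obtain ⟨P, hP, hPa, hPs⟩ := SemiMatching.exists_protocol_graphOn (A := A) hB
    obtain ⟨Q, hQ, hQa, hQs⟩ := SemiMatching.exists_protocol_union_graphOn (A := A) hB
    rw [add_assoc, one_add_one_eq_two] at hPa hQa
    refine ⟨⟨P, ?_, hPa, fun _ => hPs⟩, ⟨Q, ?_, hQa, fun _ => hQs⟩⟩
    · rwa [hP]
    · rw [hQ, Nat.cast_mul]
      push_cast at hbits ⊢
      linarith
  · obtain ⟨P, hP, hPa⟩ :=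
      SemiMatching.exists_protocol_of_card_le_one (A := A) (Nat.le_of_lt_succ hB)
    have hlog : 0 ≤ Real.logb 2 (Fintype.card B : ℝ) := by
      interval_cases Fintype.card B <;> simp
    have h₁ : 0 ≤ (Fintype.card A : ℝ) ^ (1 / 2 : ℝ) := by positivity
    have h₂ : 0 ≤ (Fintype.card A : ℝ) ^ (1 / 3 : ℝ) := by positivity
    refine ⟨⟨P, ?_, hPa _ (by linarith), fun h => absurd h (by omega)⟩,
      ⟨P, ?_, hPa _ (by linarith), fun h => absurd h (by omega)⟩⟩
    all_goals
      rw [hP, Nat.cast_zero]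
      positivity
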